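/- Let $\{N(t):t\ge 0\}$ be a nonhomogeneous Poisson process with nonnegative, locally integrable intensity $\lambda$, let $\Lambda(t)=\int_0^t\lambda(u)\,du$, let $T\ge 1$ and $B>0$, and put $\bar\Lambda_T=\Lambda(T)/T$ and $\bar N_T=N(T)/T$. Let $w$ be a real function with $|w(t)|\le 1$ for $t\in[0,T]$ that is differentiable on $(0,T)$ with $\sup_{t\in(0,T)}|w'(t)|<\infty$, and let $$\tilde\varepsilon^{w}(\nu)=\int_0^T e^{-2\pi i\nu t}w(t)\,dN(t)-\int_0^T e^{-2\pi i\nu t}w(t)\lambda(t)\,dt .$$ Let $0<\beta<1$, $\gamma>1$ and $\alpha\ge\gamma/(\gamma-1)$, and suppose that $2\gamma\pi BT\ge 1$. Then, with probability at least $$1-8\gamma\pi B\left[\frac{1}{T^{\left(\frac{\gamma-1}{\gamma}\alpha\right)^2-1}}+T\exp\left\{-(\Lambda(T)\log T)^{1/2}\right\}\right]-2e^{-\Lambda(T)\beta^2/4},$$ the following hold simultaneously: $$(1-\beta)\bar\Lambda_T<\bar N_T<(1+\beta)\bar\Lambda_T$$ and $$\sup_{\nu\in[0,B]}\frac{|\tilde\varepsilon^{w}(\nu)|}{T}<4\alpha\bar\Lambda_T^{1/2}\left(\frac{\log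 T}{T}\right)^{1/2}<\frac{4\alpha\bar N_T^{1/2}}{(1-\beta)^{1/2}}\left(\frac{\log T}{T}\right)^{1/2}.$$ -/

import Mathlib

open MeasureTheory ProbabilityTheory Set
open scoped NNReal

noncomputable section

/-- A counting process on `[0, ∞)`: `N t ω` is the number of arrivals in `(0, t]`. Every path
starts at `0`, is nondecreasing, `ℕ`-valued and right-continuous. -/
structure CountingProcess (Ω : Type*) where
  /-- The number of arrivals in `(0, t]`. -/
  toFun : ℝ≥0 → Ω → ℕ
  zero' : ∀ ω, toFun 0 ω = 0
  mono' : ∀ ω, Monotone fun t => toFun t ω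
  right_continuous' : ∀ ω t, ContinuousWithinAt (fun s => toFun s ω) (Ici t) t

namespace CountingProcess

variable {Ω : Type*}

instance : CoeFun (CountingProcess Ω) fun _ => ℝ≥0 → Ω → ℕ := ⟨toFun⟩

/-- The path `t ↦ N t ω` as a right-continuous nondecreasing function on `ℝ`, equal to `0` for
`t ≤ 0`. -/
def stieltjes (N : CountingProcess Ω) (ω : Ω) : StieltjesFunction ℝ where
  toFun t := (N t.toNNReal ω : ℝ)
  mono' := fun _ _ h => Nat.cast_le.mpr (N.mono' ω (Real.toNNReal_mono h))
  right_continuous' := fun x =>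
    (continuous_of_discreteTopology (f := (Nat.cast : ℕ → ℝ))).continuousAt.comp_continuousWithinAt
      ((N.right_continuous' ω x.toNNReal).comp continuous_real_toNNReal.continuousWithinAt
        fun _ h => Real.toNNReal_mono h)

/-- The random measure `dN`, which has an atom of mass `k` where the path jumps by `k`. -/
def jumpMeasure (N : CountingProcess Ω) (ω : Ω) : Measure ℝ := (N.stieltjes ω).measure

end CountingProcess

/-- The cumulative rate `Λ(t) = ∫₀ᵗ λ(u) du` of an intensity function. -/
def cumulativeRate (rate : ℝ → ℝ) (t : ℝ) : ℝ := ∫ u in (0 : ℝ)..t, rate u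

/-- `N` is a nonhomogeneous Poisson process with intensity function `rate`: the intensity is
nonnegative and locally integrable on `[0, ∞)`, increments over disjoint intervals are independent,
and `N(t) - N(s)` is Poisson distributed with mean `Λ(t) - Λ(s)` for `s ≤ t`. -/
structure IsNHPP {Ω : Type*} [MeasurableSpace Ω] (N : CountingProcess Ω) (rate : ℝ → ℝ)
    (μ : Measure Ω) : Prop where
  rate_nonneg : ∀ t, 0 ≤ t → 0 ≤ rate t
  rate_integrable : ∀ t, 0 ≤ t → IntervalIntegrable rate volume 0 t
  measurable : ∀ t, Measurable (N t)
  indep : HasIndepIncrements N.toFun μ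
  law : ∀ s t : ℝ≥0, s ≤ t → HasLaw (fun ω => N t ω - N s ω)
    (poissonMeasure (cumulativeRate rate t - cumulativeRate rate s).toNNReal) μ

/-- The spectrum of the windowed noise at frequency `ν`,
`∫₀ᵀ e^{-2πiνt} w(t) dε(t)` with `dε(t) = dN(t) - λ(t) dt`. -/
def windowedNoise {Ω : Type*} (N : CountingProcess Ω) (rate w : ℝ → ℝ) (T : ℝ) (ω : Ω) (ν : ℝ) :
    ℂ :=
  (∫ t in Ioc 0 T, Complex.exp (-2 * Real.pi * Complex.I * ν * t) * w t ∂(N.jumpMeasure ω)) -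
    ∫ t in Ioc 0 T, Complex.exp (-2 * Real.pi * Complex.I * ν * t) * w t * rate t

/-- The average rate `Λ(T) / T`. -/
def averageRate (rate : ℝ → ℝ) (T : ℝ) : ℝ := cumulativeRate rate T / T

/-- The empirical average rate `N(T) / T`. -/
def empiricalRate {Ω : Type*} (N : CountingProcess Ω) (T : ℝ) (ω : Ω) : ℝ :=
  (N T.toNNReal ω : ℝ) / T

end

open Filter Topology

/-! Write `Λ = Λ(T)`, `L = log T`. For a real window `g` with `|g| ≤ 1`, independence of increments,
the Poisson moment generating function and `e^y ≤ 1 + y + y²` bound the exponential moment at `0 ≤ s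
≤ 3/2` of `∫ g dε`, where `dε = dN - λ dt`, by `exp (s² Λ)`. Chernoff's method then gives a Gaussian
tail up to `3Λ` and an exponential one beyond. Constant `g` controls `N(T)`; real and imaginary
parts control the noise at one frequency.

Uniformity in `ν` comes from a power series. If `ν` is near a grid frequency, the kernel changes by
a factor `e^{z t/T}` with `‖z‖ ≤ 1/(2γ)`, and each coefficient `(t/T)^k φ(t)` of its expansion is
again a window bounded by one. Requiring the `k`-th integral to stay below `2^k k! τ`, with `τ =
4c√(ΛL)`, makes the sum at most `τ(1 + 1/γ + 1/γ² + ...) = τγ/(γ-1)`; the choice `c = α(γ-1)/γ`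
turns this into `4α√(ΛL)`. The growing thresholds make the failure probabilities summable over `k`,
so a union bound over `k` and the grid suffices.

The carrying lemmas are `lintegral_exp_integral_le`, `measure_norm_tail_le`,
`norm_compensatedIntegral_exp_mul_le` and `measure_not_forall_windowedNoise_le`. -/

/-! ### Exponential moments of Poisson increments -/

/-- The range `y ≤ 3 / 2` fixes the admissible Chernoff parameters, hence the crossover at `3Λ`
between the two tail regimes. For `y ≤ 0` it follows from `e^{-y} ≥ 1 - y` and `(1 + y + y²)(1 - y)
= 1 - y³ ≥ 1`. -/
theorem exp_le_one_add_add_sq {y : ℝ} (hy : y ≤ 3 / 2) : Real.exp y ≤ 1 + y + y ^ 2 := by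
  rcases le_total y 0 with h | h
  · have h1 : 1 - y ≤ Real.exp (-y) := by linarith [Real.add_one_le_exp (-y)]
    have h2 : Real.exp y * Real.exp (-y) = 1 := by rw [← Real.exp_add]; simp
    have h3 := Real.exp_pos y
    have h4 : Real.exp y * (1 - y) ≤ 1 :=
      (mul_le_mul_of_nonneg_left h1 h3.le).trans h2.le
    have h5 : (1 : ℝ) ≤ (1 + y + y ^ 2) * (1 - y) := by nlinarith [sq_nonneg y]
    exact le_of_mul_le_mul_right (h4.trans h5) (by linarith)
  · obtain ⟨z, rfl⟩ : ∃ z, y = 2 * z := ⟨y / 2, by ring⟩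
    have hz : 0 ≤ z := by linarith
    have hz' : z ≤ 3 / 4 := by linarith
    have h1 := Real.exp_bound' hz (by linarith) (n := 3) (by norm_num)
    simp only [Finset.sum_range_succ, Finset.sum_range_zero, Nat.factorial] at h1
    norm_num at h1
    have h2 : Real.exp (2 * z) = Real.exp z ^ 2 := by rw [← Real.exp_nat_mul]; norm_num
    have h3 : Real.exp z ^ 2 ≤ (1 + z + z ^ 2 / 2 + z ^ 3 * (2 / 9)) ^ 2 := by
      apply pow_le_pow_left₀ (Real.exp_pos z).le
      linarith
    -- Expanding the square, subtracting `1 + 2z + 4z²` and dividing by `z²` leaves exactly this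
    -- inequality.
    have h4 : (13 / 9) * z + 25 / 36 * z ^ 2 + 2 / 9 * z ^ 3 + 4 / 81 * z ^ 4 ≤ 2 := by
      have e2 : z ^ 2 ≤ (3 / 4) ^ 2 := pow_le_pow_left₀ hz hz' 2
      have e3 : z ^ 3 ≤ (3 / 4) ^ 3 := pow_le_pow_left₀ hz hz' 3
      have e4 : z ^ 4 ≤ (3 / 4) ^ 4 := pow_le_pow_left₀ hz hz' 4
      norm_num at e2 e3 e4
      linarith
    have h5 := mul_le_mul_of_nonneg_left h4 (sq_nonneg z)
    rw [h2]
    nlinarith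

theorem lintegral_exp_mul_poissonMeasure (r : ℝ≥0) (a : ℝ) :
    ∫⁻ n, ENNReal.ofReal (Real.exp (a * n)) ∂(poissonMeasure r) =
      ENNReal.ofReal (Real.exp ((Real.exp a - 1) * r)) := by
  have hs : HasSum (fun n : ℕ => Real.exp (-r) * r ^ n / n.factorial * Real.exp (a * n))
      (Real.exp ((Real.exp a - 1) * r)) := by
    have h := (NormedSpace.expSeries_div_hasSum_exp ((r : ℝ) * Real.exp a)).mul_left
      (Real.exp (-r))
    rw [← Real.exp_eq_exp_ℝ, ← Real.exp_add] at h
    convert! h using 1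
    · ext n
      rw [mul_pow, ← Real.exp_nat_mul, mul_comm (n : ℝ) a]
      ring
    · ring_nf
  rw [poissonMeasure, lintegral_sum_measure]
  simp only [lintegral_smul_measure, lintegral_dirac, smul_eq_mul]
  rw [← hs.tsum_eq, ENNReal.ofReal_tsum_of_nonneg (fun n => by positivity) hs.summable]
  congr 1
  ext n
  rw [← ENNReal.ofReal_mul (by positivity)]

theorem cumulativeRate_sub {rate : ℝ → ℝ}
    (hi : ∀ t, 0 ≤ t → IntervalIntegrable rate volume 0 t) {s t : ℝ} (hs : 0 ≤ s) (ht : 0 ≤ t) :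
    cumulativeRate rate t - cumulativeRate rate s = ∫ u in s..t, rate u :=
  intervalIntegral.integral_interval_sub_left (hi t ht) (hi s hs)

theorem cumulativeRate_mono {rate : ℝ → ℝ} (h0 : ∀ t, 0 ≤ t → 0 ≤ rate t)
    (hi : ∀ t, 0 ≤ t → IntervalIntegrable rate volume 0 t) {s t : ℝ} (hs : 0 ≤ s) (hst : s ≤ t) :
    cumulativeRate rate s ≤ cumulativeRate rate t := by
  rw [← sub_nonneg, cumulativeRate_sub hi hs (hs.trans hst)]
  exact intervalIntegral.integral_nonneg hst fun u hu => h0 u (hs.trans hu.1)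

/-- The exponential moment of a linear combination of consecutive increments. -/
theorem IsNHPP.lintegral_exp_sum {Ω : Type*} [MeasurableSpace Ω] {μ : Measure Ω}
    {N : CountingProcess Ω} {rate : ℝ → ℝ} (hN : IsNHPP N rate μ) {t : ℕ → ℝ≥0}
    (ht : Monotone t) (c : ℕ → ℝ) (n : ℕ) :
    ∫⁻ ω, ENNReal.ofReal (Real.exp (∑ i ∈ Finset.range n,
        c i * ((N (t (i + 1)) ω : ℝ) - N (t i) ω))) ∂μ =
      ENNReal.ofReal (Real.exp (∑ i ∈ Finset.range n, (Real.exp (c i) - 1) *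
        (cumulativeRate rate (t (i + 1)) - cumulativeRate rate (t i)))) := by
  have hind := (hN.indep.nat ht).comp
    (fun i k => ENNReal.ofReal (Real.exp (c i * (k : ℝ)))) (fun i => Measurable.of_discrete)
  have key := lintegral_prod_eq_prod_lintegral_of_indepFun (Finset.range n) _ hind
    (fun i => Measurable.of_discrete.comp ((hN.measurable _).sub (hN.measurable _)))
  simp only [Function.comp_apply] at key
  rw [Real.exp_sum, ENNReal.ofReal_prod_of_nonneg fun _ _ => (Real.exp_pos _).le]
  convert! key using 1
  · refine lintegral_congr fun ω => ?_
    rw [Real.exp_sum, ENNReal.ofReal_prod_of_nonneg fun _ _ => (Real.exp_pos _).le]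
    refine Finset.prod_congr rfl fun i _ => ?_
    rw [Nat.cast_sub (N.mono' ω (ht i.le_succ))]
  · refine Finset.prod_congr rfl fun i _ => ?_
    have hle := ht i.le_succ
    have h := (hN.law _ _ hle).lintegral_comp
      (f := fun k : ℕ => ENNReal.ofReal (Real.exp (c i * (k : ℝ)))) (by fun_prop)
    rw [h, lintegral_exp_mul_poissonMeasure, Real.coe_toNNReal]
    exact sub_nonneg.2 (cumulativeRate_mono hN.rate_nonneg hN.rate_integrable (t i).2
      (by exact_mod_cast hle))

/-! ### Step approximation on half-open cells -/

/-- The `n`-th step approximation of `g` on `(0, T]`, by values at right endpoints. -/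
noncomputable def rightStep (T : ℝ) (n : ℕ) (g : ℝ → ℝ) (t : ℝ) : ℝ := g (⌈n * t / T⌉ * T / n)

theorem measurable_rightStep (T : ℝ) (n : ℕ) (g : ℝ → ℝ) : Measurable (rightStep T n g) := by
  have h : Measurable fun k : ℤ => g (k * T / n) := Measurable.of_discrete
  exact h.comp (Int.measurable_ceil.comp (by fun_prop))

theorem rightStep_eq {T : ℝ} (hT : 0 < T) {n : ℕ} (hn : 0 < n) (g : ℝ → ℝ) (i : ℕ) {t : ℝ}
    (ht : t ∈ Ioc (i * T / n) ((i + 1 : ℕ) * T / n)) :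
    rightStep T n g t = g ((i + 1 : ℕ) * T / n) := by
  have hn' : (0 : ℝ) < n := by exact_mod_cast hn
  have h : ⌈(n : ℝ) * t / T⌉ = ((i + 1 : ℕ) : ℤ) := by
    rw [Int.ceil_eq_iff]
    obtain ⟨h1, h2⟩ := ht
    rw [div_lt_iff₀ hn'] at h1
    rw [le_div_iff₀ hn'] at h2
    push_cast at *
    constructor
    · rw [lt_div_iff₀ hT]; nlinarith
    · rw [div_le_iff₀ hT]; nlinarith
  rw [rightStep, h]
  push_cast
  rfl

theorem ceil_mul_div_mem {T : ℝ} (hT : 0 < T) {n : ℕ} (hn : 0 < n) {t : ℝ} (ht : t ∈ Ioc 0 T) :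
    (⌈n * t / T⌉ * T / n : ℝ) ∈ Icc t T := by
  have hn' : (0 : ℝ) < n := by exact_mod_cast hn
  constructor
  · rw [le_div_iff₀ hn', ← div_le_iff₀ hT, mul_comm t]
    exact Int.le_ceil _
  · rw [div_le_iff₀ hn', mul_comm T]
    refine mul_le_mul_of_nonneg_right ?_ hT.le
    have : ⌈(n : ℝ) * t / T⌉ ≤ (n : ℤ) := by
      rw [Int.ceil_le, div_le_iff₀ hT]
      push_cast
      exact mul_le_mul_of_nonneg_left ht.2 hn'.le
    exact_mod_cast this

/-- Right endpoints make the approximation exact at `t = T`, so no continuity is needed there,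
although `dN` may have an atom at `T`. -/
theorem tendsto_rightStep {T : ℝ} (hT : 0 < T) {g : ℝ → ℝ} (hg : ContinuousOn g (Ioo 0 T)) {t : ℝ}
    (ht : t ∈ Ioc 0 T) : Tendsto (fun n : ℕ => rightStep T (n + 1) g t) atTop (𝓝 (g t)) := by
  have hmem : ∀ n : ℕ, (⌈(n + 1 : ℕ) * t / T⌉ * T / (n + 1 : ℕ) : ℝ) ∈ Icc t T := fun n =>
    ceil_mul_div_mem hT n.succ_pos ht
  rcases eq_or_lt_of_le ht.2 with h | h
  · refine tendsto_const_nhds.congr fun n => ?_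
    rw [rightStep]
    congr 1
    exact le_antisymm (hmem n).1 (h ▸ (hmem n).2)
  · have hc : ContinuousAt g t := hg.continuousAt (Ioo_mem_nhds ht.1 h)
    refine hc.tendsto.comp ?_
    have hup : Tendsto (fun n : ℕ => t + T * (1 / ((n : ℝ) + 1))) atTop (𝓝 t) := by
      simpa using (tendsto_one_div_add_atTop_nhds_zero_nat (𝕜 := ℝ)).const_mul T |>.const_add t
    refine tendsto_of_tendsto_of_tendsto_of_le_of_le tendsto_const_nhds hup
      (fun n => (hmem n).1) fun n => ?_
    have hn' : (0 : ℝ) < ((n + 1 : ℕ) : ℝ) := by positivity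
    have := (Int.ceil_lt_add_one (((n + 1 : ℕ) : ℝ) * t / T)).le
    show _ ≤ _
    rw [div_le_iff₀ hn']
    calc _ ≤ (((n + 1 : ℕ) : ℝ) * t / T + 1) * T := mul_le_mul_of_nonneg_right this hT.le
      _ = _ := by push_cast; field_simp

theorem sum_rightStep {T : ℝ} (hT : 0 < T) {n : ℕ} (hn : 0 < n) (g : ℝ → ℝ) (m : Measure ℝ)
    [IsLocallyFiniteMeasure m] :
    ∑ i ∈ Finset.range n, g ((i + 1 : ℕ) * T / n) *
        m.real (Ioc (i * T / n : ℝ) ((i + 1 : ℕ) * T / n)) =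
      ∫ t in Ioc 0 T, rightStep T n g t ∂m := by
  have hn' : (0 : ℝ) < n := by exact_mod_cast hn
  have hle : ∀ i : ℕ, (i * T / n : ℝ) ≤ (i + 1 : ℕ) * T / n := fun i => by
    push_cast
    gcongr
    linarith
  have hcell : ∀ i : ℕ, Set.EqOn (rightStep T n g) (fun _ => g ((i + 1 : ℕ) * T / n))
      (Ioc (i * T / n : ℝ) ((i + 1 : ℕ) * T / n)) := fun i t ht => rightStep_eq hT hn g i ht
  have h := intervalIntegral.sum_integral_adjacent_intervals (μ := m) (f := rightStep T n g)
    (a := fun i : ℕ => (i * T / n : ℝ)) (n := n) fun k _ => by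
      rw [intervalIntegrable_iff_integrableOn_Ioc_of_le (hle k)]
      refine IntegrableOn.congr_fun (integrableOn_const ?_ ?_) (hcell k).symm measurableSet_Ioc
      · exact measure_Ioc_lt_top.ne
      · simp
  simp only [Nat.cast_zero, zero_mul, zero_div, mul_div_cancel_left₀ _ hn'.ne'] at h
  rw [intervalIntegral.integral_of_le hT.le] at h
  rw [← h]
  refine Finset.sum_congr rfl fun i _ => ?_
  rw [intervalIntegral.integral_of_le (hle i), setIntegral_congr_fun measurableSet_Ioc (hcell i),
    setIntegral_const, smul_eq_mul, mul_comm]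

theorem tendsto_integral_rightStep {T C : ℝ} (hT : 0 < T) {g : ℝ → ℝ}
    (hg : ContinuousOn g (Ioo 0 T)) (hC : ∀ t ∈ Ioc 0 T, |g t| ≤ C) (m : Measure ℝ)
    [IsLocallyFiniteMeasure m] :
    Tendsto (fun n : ℕ => ∫ t in Ioc 0 T, rightStep T (n + 1) g t ∂m) atTop
      (𝓝 (∫ t in Ioc 0 T, g t ∂m)) := by
  have : IsFiniteMeasure (m.restrict (Ioc 0 T)) :=
    ⟨by rw [Measure.restrict_apply_univ]; exact measure_Ioc_lt_top⟩
  refine tendsto_integral_of_dominated_convergence (fun _ => C)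
    (fun n => (measurable_rightStep _ _ _).aestronglyMeasurable) (integrable_const C)
    (fun n => ?_) ?_
  · refine ae_restrict_of_forall_mem measurableSet_Ioc fun t ht => ?_
    have := ceil_mul_div_mem hT n.succ_pos ht
    exact hC _ ⟨ht.1.trans_le this.1, this.2⟩
  · exact ae_restrict_of_forall_mem measurableSet_Ioc fun t ht => tendsto_rightStep hT hg ht

theorem aestronglyMeasurable_of_continuousOn_Ioo {T : ℝ} (hT : 0 < T) {g : ℝ → ℝ}
    (hg : ContinuousOn g (Ioo 0 T)) (m : Measure ℝ) :
    AEStronglyMeasurable g (m.restrict (Ioc 0 T)) :=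
  aestronglyMeasurable_of_tendsto_ae atTop
    (fun n => (measurable_rightStep T (n + 1) g).aestronglyMeasurable)
    (ae_restrict_of_forall_mem measurableSet_Ioc fun _ ht => tendsto_rightStep hT hg ht)

instance {Ω : Type*} (N : CountingProcess Ω) (ω : Ω) : IsLocallyFiniteMeasure (N.jumpMeasure ω) :=
  inferInstanceAs (IsLocallyFiniteMeasure (N.stieltjes ω).measure)

theorem CountingProcess.jumpMeasure_real_Ioc {Ω : Type*} (N : CountingProcess Ω) (ω : Ω) {a b : ℝ}
    (hab : a ≤ b) : (N.jumpMeasure ω).real (Ioc a b) = (N b.toNNReal ω : ℝ) - N a.toNNReal ω := by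
  rw [Measure.real, jumpMeasure, StieltjesFunction.measure_Ioc, ENNReal.toReal_ofReal]
  · rfl
  · exact sub_nonneg.2 ((N.stieltjes ω).mono hab)

theorem CountingProcess.integral_rightStep {Ω : Type*} (N : CountingProcess Ω) {T : ℝ} (hT : 0 < T) (n : ℕ) (g : ℝ → ℝ)
    (ω : Ω) :
    ∫ t in Ioc 0 T, rightStep T (n + 1) g t ∂(N.jumpMeasure ω) =
      ∑ i ∈ Finset.range (n + 1), g ((i + 1 : ℕ) * T / (n + 1 : ℕ)) *
        ((N (((i + 1 : ℕ) * T / (n + 1 : ℕ) : ℝ).toNNReal) ω : ℝ) -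
          N ((i * T / (n + 1 : ℕ) : ℝ).toNNReal) ω) := by
  rw [← sum_rightStep hT n.succ_pos]
  refine Finset.sum_congr rfl fun i _ => ?_
  rw [CountingProcess.jumpMeasure_real_Ioc]
  push_cast
  gcongr
  linarith

/-! ### The intensity measure and compensated integrals -/

/-- The intensity measure `λ(t) dt` on `(0, T]`. -/
noncomputable def rateMeasure (rate : ℝ → ℝ) (T : ℝ) : Measure ℝ :=
  (volume.restrict (Ioc 0 T)).withDensity fun t => ENNReal.ofReal (rate t)

section rateMeasure

variable {rate : ℝ → ℝ} {T : ℝ}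

theorem isFiniteMeasure_rateMeasure (hT : 0 ≤ T) (hi : IntervalIntegrable rate volume 0 T) :
    IsFiniteMeasure (rateMeasure rate T) :=
  isFiniteMeasure_withDensity_ofReal
    ((intervalIntegrable_iff_integrableOn_Ioc_of_le hT).1 hi).hasFiniteIntegral

theorem rateMeasure_real_Ioc (h0 : ∀ t, 0 ≤ t → 0 ≤ rate t)
    (hi : ∀ t, 0 ≤ t → IntervalIntegrable rate volume 0 t) {a b : ℝ} (ha : 0 ≤ a) (hab : a ≤ b)
    (hb : b ≤ T) :
    (rateMeasure rate T).real (Ioc a b) = cumulativeRate rate b - cumulativeRate rate a := by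
  have hsub : Ioc a b ⊆ Ioc 0 T := Ioc_subset_Ioc ha hb
  have hnn : ∀ t ∈ Ioc a b, 0 ≤ rate t := fun t ht => h0 t (ha.trans ht.1.le)
  rw [Measure.real, rateMeasure, withDensity_apply _ measurableSet_Ioc,
    Measure.restrict_restrict measurableSet_Ioc, inter_eq_left.2 hsub,
    cumulativeRate_sub hi ha (ha.trans hab), intervalIntegral.integral_of_le hab,
    ← ofReal_integral_eq_lintegral_ofReal, ENNReal.toReal_ofReal]
  · exact setIntegral_nonneg measurableSet_Ioc hnn
  · exact ((intervalIntegrable_iff_integrableOn_Ioc_of_le ((ha.trans hab).trans hb)).1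
      (hi T ((ha.trans hab).trans hb))).mono_set hsub
  · exact ae_restrict_of_forall_mem measurableSet_Ioc hnn

theorem setIntegral_rateMeasure (hT : 0 ≤ T) (h0 : ∀ t, 0 ≤ t → 0 ≤ rate t)
    (hi : IntervalIntegrable rate volume 0 T) (φ : ℝ → ℂ) :
    ∫ t in Ioc 0 T, φ t ∂(rateMeasure rate T) = ∫ t in Ioc 0 T, φ t * rate t := by
  have hm := ((intervalIntegrable_iff_integrableOn_Ioc_of_le hT).1 hi).aestronglyMeasurable
  rw [rateMeasure, restrict_withDensity measurableSet_Ioc,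
    Measure.restrict_restrict measurableSet_Ioc, inter_self,
    integral_withDensity_eq_integral_toReal_smul₀ hm.aemeasurable.ennreal_ofReal (by simp)]
  refine setIntegral_congr_fun measurableSet_Ioc fun t ht => ?_
  rw [ENNReal.toReal_ofReal (h0 t ht.1.le), Complex.real_smul, mul_comm]

end rateMeasure

/-- The integral over `(0, T]` of `φ` against the compensated process `dN(t) - λ(t) dt`. -/
noncomputable def compensatedIntegral {Ω E : Type*} [NormedAddCommGroup E] [NormedSpace ℝ E]
    (N : CountingProcess Ω) (rate : ℝ → ℝ) (T : ℝ) (φ : ℝ → E) (ω : Ω) : E :=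
  (∫ t in Ioc 0 T, φ t ∂(N.jumpMeasure ω)) - ∫ t in Ioc 0 T, φ t ∂(rateMeasure rate T)

/-! ### Exponential moments and tails of real compensated integrals -/

namespace IsNHPP

variable {Ω : Type*} [MeasurableSpace Ω] {μ : Measure Ω} {N : CountingProcess Ω} {rate : ℝ → ℝ}
  {T : ℝ} {g : ℝ → ℝ}

theorem cumulativeRate_nonneg (hN : IsNHPP N rate μ) (hT : 0 ≤ T) : 0 ≤ cumulativeRate rate T := by
  have := cumulativeRate_mono hN.rate_nonneg hN.rate_integrable le_rfl hT
  simpa [cumulativeRate] using this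

theorem measurable_integral_rightStep (hN : IsNHPP N rate μ) (hT : 0 < T) (n : ℕ) (g : ℝ → ℝ) :
    Measurable fun ω => ∫ t in Ioc 0 T, rightStep T (n + 1) g t ∂(N.jumpMeasure ω) := by
  simp only [N.integral_rightStep hT]
  refine Finset.measurable_fun_sum _ fun i _ => Measurable.const_mul ?_ _
  exact ((measurable_of_countable _).comp (hN.measurable _)).sub
    ((measurable_of_countable _).comp (hN.measurable _))

/-- On each cell the Poisson exponent has the factor `e^{sy} - 1 ≤ sy + s²y² ≤ sy + s²`; the terms
`s²` telescope to `s² Λ(T)`. -/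
theorem lintegral_exp_rightStep_le (hN : IsNHPP N rate μ) (hT : 0 < T)
    (hg1 : ∀ t ∈ Ioc 0 T, |g t| ≤ 1) {s : ℝ} (hs0 : 0 ≤ s) (hs : s ≤ 3 / 2) (n : ℕ) :
    ∫⁻ ω, ENNReal.ofReal (Real.exp
        (s * ∫ t in Ioc 0 T, rightStep T (n + 1) g t ∂(N.jumpMeasure ω))) ∂μ ≤
      ENNReal.ofReal (Real.exp (s * (∫ t in Ioc 0 T, rightStep T (n + 1) g t
        ∂(rateMeasure rate T)) + s ^ 2 * cumulativeRate rate T)) := by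
  have hn : (0 : ℝ) < (n + 1 : ℕ) := by positivity
  have hmono : Monotone fun i : ℕ => (i * T / (n + 1 : ℕ) : ℝ) := fun i j hij => by
    have : (i : ℝ) ≤ j := by exact_mod_cast hij
    simp only
    gcongr
  have hnn : ∀ i : ℕ, (0 : ℝ) ≤ i * T / (n + 1 : ℕ) := fun i => by positivity
  have hfin := isFiniteMeasure_rateMeasure hT.le (hN.rate_integrable T hT.le)
  have h := hN.lintegral_exp_sum
    (t := fun i : ℕ => (i * T / (n + 1 : ℕ) : ℝ).toNNReal)
    (fun i j hij => Real.toNNReal_mono (hmono hij))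
    (fun i => s * g ((i + 1 : ℕ) * T / (n + 1 : ℕ))) (n + 1)
  simp only [N.integral_rightStep hT, Finset.mul_sum, ← mul_assoc]
  rw [h]
  refine ENNReal.ofReal_le_ofReal (Real.exp_le_exp.2 ?_)
  simp only [Real.coe_toNNReal _ (hnn _)]
  have htel : cumulativeRate rate T = ∑ i ∈ Finset.range (n + 1),
      (cumulativeRate rate ((i + 1 : ℕ) * T / (n + 1 : ℕ)) -
        cumulativeRate rate (i * T / (n + 1 : ℕ))) := by
    rw [Finset.sum_range_sub fun i : ℕ => cumulativeRate rate (i * T / (n + 1 : ℕ))]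
    simp [mul_div_cancel_left₀ _ hn.ne', cumulativeRate, -Nat.cast_add]
  rw [← sum_rightStep hT n.succ_pos, htel, Finset.mul_sum, Finset.mul_sum,
    ← Finset.sum_add_distrib]
  refine Finset.sum_le_sum fun i hi => ?_
  have hin : i + 1 ≤ n + 1 := Finset.mem_range.1 hi
  have hle : ((i + 1 : ℕ) * T / (n + 1 : ℕ) : ℝ) ≤ T := by
    have := hmono hin
    simpa only [mul_div_cancel_left₀ _ hn.ne'] using this
  have hpos : (0 : ℝ) < (i + 1 : ℕ) * T / (n + 1 : ℕ) := by positivity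
  rw [rateMeasure_real_Ioc hN.rate_nonneg hN.rate_integrable (hnn i) (hmono i.le_succ) hle,
    ← mul_assoc, ← add_mul]
  refine mul_le_mul_of_nonneg_right ?_ (sub_nonneg.2 (cumulativeRate_mono hN.rate_nonneg
    hN.rate_integrable (hnn i) (hmono i.le_succ)))
  set y := g ((i + 1 : ℕ) * T / (n + 1 : ℕ)) with hy
  have hy1 : |y| ≤ 1 := hg1 _ ⟨hpos, hle⟩
  have h1 := abs_le.1 hy1
  have h2 := exp_le_one_add_add_sq (y := s * y) (by nlinarith)
  have h3 : y ^ 2 ≤ 1 := (sq_le_one_iff_abs_le_one y).2 hy1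
  nlinarith [mul_le_mul_of_nonneg_left h3 (sq_nonneg s)]

theorem measurable_integral (hN : IsNHPP N rate μ) (hT : 0 < T) (hg : ContinuousOn g (Ioo 0 T))
    (hg1 : ∀ t ∈ Ioc 0 T, |g t| ≤ 1) :
    Measurable fun ω => ∫ t in Ioc 0 T, g t ∂(N.jumpMeasure ω) :=
  measurable_of_tendsto_metrizable (fun n => hN.measurable_integral_rightStep hT n g)
    (tendsto_pi_nhds.2 fun ω => tendsto_integral_rightStep hT hg hg1 (N.jumpMeasure ω))

/-- Fatou's lemma suffices to pass to the limit of the step functions, because only an upper bound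
is wanted. -/
theorem lintegral_exp_integral_le (hN : IsNHPP N rate μ) (hT : 0 < T)
    (hg : ContinuousOn g (Ioo 0 T)) (hg1 : ∀ t ∈ Ioc 0 T, |g t| ≤ 1) {s : ℝ} (hs0 : 0 ≤ s)
    (hs : s ≤ 3 / 2) :
    ∫⁻ ω, ENNReal.ofReal (Real.exp (s * ∫ t in Ioc 0 T, g t ∂(N.jumpMeasure ω))) ∂μ ≤
      ENNReal.ofReal (Real.exp (s * (∫ t in Ioc 0 T, g t ∂(rateMeasure rate T)) +
        s ^ 2 * cumulativeRate rate T)) := by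
  have hfin := isFiniteMeasure_rateMeasure hT.le (hN.rate_integrable T hT.le)
  have hF : Continuous fun x : ℝ => ENNReal.ofReal (Real.exp (s * x)) :=
    ENNReal.continuous_ofReal.comp (by fun_prop)
  have hG : Continuous fun x : ℝ =>
      ENNReal.ofReal (Real.exp (s * x + s ^ 2 * cumulativeRate rate T)) :=
    ENNReal.continuous_ofReal.comp (by fun_prop)
  have hlim : ∀ ω, Tendsto (fun n : ℕ => ENNReal.ofReal (Real.exp
      (s * ∫ t in Ioc 0 T, rightStep T (n + 1) g t ∂(N.jumpMeasure ω)))) atTop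
      (𝓝 (ENNReal.ofReal (Real.exp (s * ∫ t in Ioc 0 T, g t ∂(N.jumpMeasure ω))))) := fun ω =>
    (hF.tendsto _).comp (tendsto_integral_rightStep hT hg hg1 (N.jumpMeasure ω))
  have hlim' := (hG.tendsto _).comp (tendsto_integral_rightStep hT hg hg1 (rateMeasure rate T))
  calc _ = ∫⁻ ω, liminf (fun n : ℕ => ENNReal.ofReal (Real.exp
      (s * ∫ t in Ioc 0 T, rightStep T (n + 1) g t ∂(N.jumpMeasure ω)))) atTop ∂μ :=
        lintegral_congr fun ω => (hlim ω).liminf_eq.symm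
    _ ≤ liminf (fun n : ℕ => ∫⁻ ω, ENNReal.ofReal (Real.exp
      (s * ∫ t in Ioc 0 T, rightStep T (n + 1) g t ∂(N.jumpMeasure ω))) ∂μ) atTop :=
        lintegral_liminf_le fun n => hF.measurable.comp (hN.measurable_integral_rightStep hT n g)
    _ ≤ liminf (fun n : ℕ => ENNReal.ofReal (Real.exp
      (s * (∫ t in Ioc 0 T, rightStep T (n + 1) g t ∂(rateMeasure rate T)) +
        s ^ 2 * cumulativeRate rate T))) atTop :=
        liminf_le_liminf (Eventually.of_forall fun n =>
          hN.lintegral_exp_rightStep_le hT hg1 hs0 hs n)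
    _ = _ := hlim'.liminf_eq

theorem measure_le_compensatedIntegral_le (hN : IsNHPP N rate μ) (hT : 0 < T)
    (hg : ContinuousOn g (Ioo 0 T)) (hg1 : ∀ t ∈ Ioc 0 T, |g t| ≤ 1) {s : ℝ} (hs0 : 0 ≤ s)
    (hs : s ≤ 3 / 2) (x : ℝ) :
    μ {ω | x ≤ compensatedIntegral N rate T g ω} ≤
      ENNReal.ofReal (Real.exp (s ^ 2 * cumulativeRate rate T - s * x)) := by
  set m := ∫ t in Ioc 0 T, g t ∂(rateMeasure rate T) with hm
  have hmeas : Measurable fun ω => ENNReal.ofReal (Real.exp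
      (s * ∫ t in Ioc 0 T, g t ∂(N.jumpMeasure ω))) :=
    ((hN.measurable_integral hT hg hg1).const_mul s).exp.ennreal_ofReal
  have hpos : 0 < Real.exp (s * (x + m)) := Real.exp_pos _
  calc _ ≤ μ {ω | ENNReal.ofReal (Real.exp (s * (x + m))) ≤
        ENNReal.ofReal (Real.exp (s * ∫ t in Ioc 0 T, g t ∂(N.jumpMeasure ω)))} := by
        refine measure_mono fun ω hω => ?_
        refine ENNReal.ofReal_le_ofReal (Real.exp_le_exp.2 (mul_le_mul_of_nonneg_left ?_ hs0))
        have h : x ≤ (∫ t in Ioc 0 T, g t ∂(N.jumpMeasure ω)) - m := hω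
        linarith
    _ ≤ _ := meas_ge_le_lintegral_div hmeas.aemeasurable (by simpa using hpos)
        ENNReal.ofReal_ne_top
    _ ≤ _ := ENNReal.div_le_div_right (hN.lintegral_exp_integral_le hT hg hg1 hs0 hs) _
    _ = _ := by
        rw [← ENNReal.ofReal_div_of_pos hpos, ← Real.exp_sub]
        congr 2
        ring

/-- A Bernstein-type tail bound in the Gaussian range. -/
theorem measure_tail_gaussian (hN : IsNHPP N rate μ) (hT : 0 < T)
    (hg : ContinuousOn g (Ioo 0 T)) (hg1 : ∀ t ∈ Ioc 0 T, |g t| ≤ 1)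
    (hΛ : 0 < cumulativeRate rate T) {x : ℝ} (hx : 0 ≤ x) (hx3 : x ≤ 3 * cumulativeRate rate T) :
    μ {ω | x ≤ compensatedIntegral N rate T g ω} ≤
      ENNReal.ofReal (Real.exp (-(x ^ 2 / (4 * cumulativeRate rate T)))) := by
  -- This `s` minimises `s² Λ - s x`; the constraint `s ≤ 3 / 2` is exactly `x ≤ 3Λ`.
  refine (hN.measure_le_compensatedIntegral_le hT hg hg1
    (s := x / (2 * cumulativeRate rate T)) (by positivity) ?_ x).trans (le_of_eq ?_)
  · rw [div_le_iff₀ (by positivity)]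
    linarith
  · congr 2
    field_simp
    ring

/-- A Bernstein-type tail bound in the exponential range. -/
theorem measure_tail_exponential (hN : IsNHPP N rate μ) (hT : 0 < T)
    (hg : ContinuousOn g (Ioo 0 T)) (hg1 : ∀ t ∈ Ioc 0 T, |g t| ≤ 1) {x : ℝ}
    (hx3 : 3 * cumulativeRate rate T ≤ x) :
    μ {ω | x ≤ compensatedIntegral N rate T g ω} ≤
      ENNReal.ofReal (Real.exp (-(3 / 4 * x))) := by
  refine (hN.measure_le_compensatedIntegral_le hT hg hg1
    (s := 3 / 2) (by norm_num) le_rfl x).trans (ENNReal.ofReal_le_ofReal (Real.exp_le_exp.2 ?_))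
  linarith

end IsNHPP

/-! ### Power series of a modulation and the frequency grid -/

theorem integrableOn_of_continuousOn_Ioo {T : ℝ} (hT : 0 < T) {φ : ℝ → ℂ}
    (hφ : ContinuousOn φ (Ioo 0 T)) (hφ1 : ∀ t ∈ Ioc 0 T, ‖φ t‖ ≤ 1) (m : Measure ℝ)
    [IsLocallyFiniteMeasure m] : IntegrableOn φ (Ioc 0 T) m := by
  have hre := aestronglyMeasurable_of_continuousOn_Ioo hT
    (Complex.continuous_re.comp_continuousOn hφ) m
  have him := aestronglyMeasurable_of_continuousOn_Ioo hT
    (Complex.continuous_im.comp_continuousOn hφ) m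
  have hmeas : AEStronglyMeasurable φ (m.restrict (Ioc 0 T)) := by
    refine ((Complex.continuous_ofReal.comp_aestronglyMeasurable hre).add
      ((Complex.continuous_ofReal.comp_aestronglyMeasurable him).mul_const Complex.I)).congr
      (Eventually.of_forall fun t => ?_)
    exact Complex.re_add_im (φ t)
  have hfin : IsFiniteMeasure (m.restrict (Ioc 0 T)) :=
    ⟨by rw [Measure.restrict_apply_univ]; exact measure_Ioc_lt_top⟩
  exact Integrable.of_bound hmeas 1 (ae_restrict_of_forall_mem measurableSet_Ioc hφ1)

theorem compensatedIntegral_comp_clm {Ω : Type*} {N : CountingProcess Ω} {rate : ℝ → ℝ} {T : ℝ}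
    (hT : 0 < T) [IsFiniteMeasure (rateMeasure rate T)] {φ : ℝ → ℂ}
    (hφ : ContinuousOn φ (Ioo 0 T)) (hφ1 : ∀ t ∈ Ioc 0 T, ‖φ t‖ ≤ 1) (L : ℂ →L[ℝ] ℝ) (ω : Ω) :
    compensatedIntegral N rate T (fun t => L (φ t)) ω = L (compensatedIntegral N rate T φ ω) := by
  rw [compensatedIntegral, compensatedIntegral, map_sub,
    L.integral_comp_comm (integrableOn_of_continuousOn_Ioo hT hφ hφ1 _),
    L.integral_comp_comm (integrableOn_of_continuousOn_Ioo hT hφ hφ1 _)]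

theorem compensatedIntegral_neg {Ω : Type*} (N : CountingProcess Ω) (rate : ℝ → ℝ) (T : ℝ)
    (g : ℝ → ℝ) (ω : Ω) :
    compensatedIntegral N rate T (fun t => -g t) ω = -compensatedIntegral N rate T g ω := by
  simp only [compensatedIntegral, integral_neg]
  ring

/-- Expansion of an exponential factor under the integral sign. -/
theorem hasSum_integral_exp_mul {T : ℝ} (hT : 0 < T) {φ : ℝ → ℂ}
    (hφ : ContinuousOn φ (Ioo 0 T)) (hφ1 : ∀ t ∈ Ioc 0 T, ‖φ t‖ ≤ 1) (m : Measure ℝ)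
    [IsLocallyFiniteMeasure m] (z : ℂ) :
    HasSum (fun k : ℕ => z ^ k / k.factorial * ∫ t in Ioc 0 T, (t / T : ℂ) ^ k * φ t ∂m)
      (∫ t in Ioc 0 T, Complex.exp (z * (t / T)) * φ t ∂m) := by
  have hfin : IsFiniteMeasure (m.restrict (Ioc 0 T)) :=
    ⟨by rw [Measure.restrict_apply_univ]; exact measure_Ioc_lt_top⟩
  have hint := integrableOn_of_continuousOn_Ioo hT hφ hφ1 m
  have hsum : Summable fun k : ℕ => ‖z‖ ^ k / k.factorial := Real.summable_pow_div_factorial _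
  simp only [← integral_const_mul]
  refine hasSum_integral_of_dominated_convergence (fun k _ => ‖z‖ ^ k / k.factorial) (fun k => ?_)
    (fun k => ?_) (Eventually.of_forall fun _ => hsum) (integrable_const _) ?_
  · have : Continuous fun t : ℝ => (t / T : ℂ) ^ k := by fun_prop
    exact (this.aestronglyMeasurable.mul hint.aestronglyMeasurable).const_mul _
  · refine ae_restrict_of_forall_mem measurableSet_Ioc fun t ht => ?_
    have h1 : ‖(t / T : ℂ)‖ ≤ 1 := by
      rw [← Complex.ofReal_div, Complex.norm_real, Real.norm_of_nonneg (div_nonneg ht.1.le hT.le)]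
      exact div_le_one_of_le₀ ht.2 hT.le
    rw [norm_mul, norm_div, norm_pow, Complex.norm_natCast, norm_mul, norm_pow]
    refine mul_le_of_le_one_right (by positivity) ?_
    exact mul_le_one₀ (pow_le_one₀ (norm_nonneg _) h1) (norm_nonneg _) (hφ1 t ht)
  · refine Eventually.of_forall fun t => ?_
    have h := (NormedSpace.expSeries_div_hasSum_exp (z * (t / T))).mul_right (φ t)
    rw [← Complex.exp_eq_exp_ℂ] at h
    convert! h using 2 with k
    rw [mul_pow]
    ring

theorem hasSum_compensatedIntegral_exp_mul {Ω : Type*} {N : CountingProcess Ω} {rate : ℝ → ℝ}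
    {T : ℝ} (hT : 0 < T) [IsFiniteMeasure (rateMeasure rate T)] {φ : ℝ → ℂ}
    (hφ : ContinuousOn φ (Ioo 0 T)) (hφ1 : ∀ t ∈ Ioc 0 T, ‖φ t‖ ≤ 1) (z : ℂ) (ω : Ω) :
    HasSum (fun k : ℕ => z ^ k / k.factorial *
        compensatedIntegral N rate T (fun t => (t / T : ℂ) ^ k * φ t) ω)
      (compensatedIntegral N rate T (fun t => Complex.exp (z * (t / T)) * φ t) ω) := by
  simp only [compensatedIntegral, mul_sub]
  exact (hasSum_integral_exp_mul hT hφ hφ1 _ z).sub (hasSum_integral_exp_mul hT hφ hφ1 _ z)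

/-- If all Taylor coefficients obey `‖F k‖ ≤ 2 ^ k k! τ`, then a modulation by at most `1 / (2γ)`
changes the integral by at most `τ / (γ - 1)`. -/
theorem norm_compensatedIntegral_exp_mul_le {Ω : Type*} {N : CountingProcess Ω} {rate : ℝ → ℝ}
    {T : ℝ} (hT : 0 < T) [IsFiniteMeasure (rateMeasure rate T)] {φ : ℝ → ℂ}
    (hφ : ContinuousOn φ (Ioo 0 T)) (hφ1 : ∀ t ∈ Ioc 0 T, ‖φ t‖ ≤ 1) {γ τ : ℝ} (hγ : 1 < γ)
    {z : ℂ} (hz : ‖z‖ ≤ 1 / (2 * γ)) {ω : Ω}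
    (hω : ∀ k : ℕ, ‖compensatedIntegral N rate T (fun t => (t / T : ℂ) ^ k * φ t) ω‖ ≤
      2 ^ k * k.factorial * τ) :
    ‖compensatedIntegral N rate T (fun t => Complex.exp (z * (t / T)) * φ t) ω‖ ≤
      ‖compensatedIntegral N rate T φ ω‖ + τ / (γ - 1) := by
  have hγ0 : 0 < γ := by linarith
  have hτ : 0 ≤ τ := by simpa using (norm_nonneg _).trans (hω 0)
  have h := hasSum_compensatedIntegral_exp_mul (N := N) (rate := rate) hT hφ hφ1 z ω
  rw [← hasSum_nat_add_iff' 1] at h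
  simp only [Finset.range_one, Finset.sum_singleton, pow_zero, Nat.factorial_zero, Nat.cast_one,
    div_one, one_mul] at h
  -- The factor `2^k k!` in the threshold cancels against `‖z‖^k / k! ≤ (2γ)^{-k} / k!`, leaving a
  -- geometric series without its zeroth term.
  have hg : HasSum (fun k : ℕ => (1 / γ) ^ (k + 1) * τ) (τ / (γ - 1)) := by
    have h1 := (hasSum_geometric_of_lt_one (r := 1 / γ) (by positivity)
      ((div_lt_one hγ0).2 hγ)).mul_left (1 / γ * τ)
    convert! h1 using 1
    · ext k
      ring
    · have : γ - 1 ≠ 0 := by linarith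
      field_simp
  have hle : ∀ k : ℕ, ‖z ^ (k + 1) / (k + 1).factorial *
      compensatedIntegral N rate T (fun t => (t / T : ℂ) ^ (k + 1) * φ t) ω‖ ≤
      (1 / γ) ^ (k + 1) * τ := fun k => by
    rw [norm_mul, norm_div, norm_pow, Complex.norm_natCast]
    calc _ ≤ (1 / (2 * γ)) ^ (k + 1) / (k + 1).factorial *
          (2 ^ (k + 1) * (k + 1).factorial * τ) := by
          gcongr
          exact hω _
      _ = _ := by
          have h2 : 1 / γ = 1 / (2 * γ) * 2 := by field_simp
          rw [h2, mul_pow]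
          field_simp
  have hb := tsum_of_norm_bounded hg hle
  rw [h.tsum_eq] at hb
  linarith [norm_sub_norm_le
    (compensatedIntegral N rate T (fun t => Complex.exp (z * (t / T)) * φ t) ω)
    (compensatedIntegral N rate T φ ω)]

/-- This lets the tail bounds be used with `a = 2^k k!` and `m = k + 1`, so that the failure
probability decays geometrically in `k`. -/
theorem succ_le_two_pow_mul_factorial (k : ℕ) : (k + 1 : ℝ) ≤ 2 ^ k * k.factorial := by
  have h1 : k + 1 ≤ 2 ^ k := Nat.lt_two_pow_self
  have h2 : k + 1 ≤ 2 ^ k * k.factorial := h1.trans (Nat.le_mul_of_pos_right _ k.factorial_pos)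
  exact_mod_cast h2

theorem exists_center_abs_sub_le {B : ℝ} (hB : 0 < B) {K : ℕ} (hK : 0 < K) {x : ℝ}
    (hx : x ∈ Icc 0 B) : ∃ j ∈ Finset.range K, |x - (j + 1 / 2) * (B / K)| ≤ B / K / 2 := by
  have hK' : (0 : ℝ) < K := by exact_mod_cast hK
  set h := B / K with hh
  have hpos : 0 < h := by positivity
  have hBK : B = K * h := by rw [hh]; field_simp
  rcases eq_or_lt_of_le hx.2 with hxB | hxB
  · refine ⟨K - 1, by simp [hK], ?_⟩
    rw [Nat.cast_sub hK, hxB, abs_le]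
    push_cast
    constructor <;> nlinarith
  · have h1 := Nat.floor_le (div_nonneg hx.1 hpos.le)
    have h2 := Nat.lt_floor_add_one (x / h)
    rw [le_div_iff₀ hpos] at h1
    rw [div_lt_iff₀ hpos] at h2
    refine ⟨⌊x / h⌋₊, ?_, ?_⟩
    · rw [Finset.mem_range, Nat.floor_lt (div_nonneg hx.1 hpos.le), div_lt_iff₀ hpos]
      linarith
    · rw [abs_le]
      constructor <;> nlinarith

/-! ### Tails at one frequency, for all Taylor coefficients at once -/

namespace IsNHPP

variable {Ω : Type*} [MeasurableSpace Ω] {μ : Measure Ω} {N : CountingProcess Ω} {rate : ℝ → ℝ}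
  {T : ℝ} {g : ℝ → ℝ}

/-- The sum on the right covers both regimes: the Gaussian exponent is `2a²c²L` with `a² ≥ m`, and
the exponential one is at least `2m√(ΛL)` because `√2 ≥ 4/3`. -/
theorem measure_tail_le (hN : IsNHPP N rate μ) (hT : 0 < T)
    (hg : ContinuousOn g (Ioo 0 T)) (hg1 : ∀ t ∈ Ioc 0 T, |g t| ≤ 1)
    (hΛ : 0 < cumulativeRate rate T) {L c a : ℝ} (hL : 0 ≤ L) (hc : 1 ≤ c) {m : ℕ} (hm : 1 ≤ m)
    (ha : m ≤ a) :
    μ {ω | 2 * √2 * c * a * √(cumulativeRate rate T * L) ≤ compensatedIntegral N rate T g ω} ≤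
      ENNReal.ofReal (Real.exp (-(c ^ 2 * L)) ^ (2 * m) +
        Real.exp (-√(cumulativeRate rate T * L)) ^ (2 * m)) := by
  set Λ := cumulativeRate rate T with hΛdef
  have hm' : (1 : ℝ) ≤ m := by exact_mod_cast hm
  have ha1 : 1 ≤ a := hm'.trans ha
  set x := 2 * √2 * c * a * √(Λ * L) with hx
  have hx0 : 0 ≤ x := by positivity
  simp only [← Real.exp_nat_mul]
  rcases le_total x (3 * Λ) with h | h
  · refine (hN.measure_tail_gaussian hT hg hg1 hΛ hx0 h).trans (ENNReal.ofReal_le_ofReal ?_)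
    refine le_add_of_le_of_nonneg (Real.exp_le_exp.2 ?_) (Real.exp_pos _).le
    have h2 : x ^ 2 / (4 * Λ) = 2 * a ^ 2 * (c ^ 2 * L) := by
      rw [hx, mul_pow, mul_pow, mul_pow, mul_pow, Real.sq_sqrt (by positivity),
        Real.sq_sqrt (by positivity)]
      field_simp
      ring
    rw [h2]
    have h3 : (m : ℝ) ≤ a ^ 2 := by nlinarith
    have h4 := mul_le_mul_of_nonneg_right h3 (by positivity : 0 ≤ c ^ 2 * L)
    push_cast
    linarith
  · refine (hN.measure_tail_exponential hT hg hg1 h).trans (ENNReal.ofReal_le_ofReal ?_)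
    refine le_add_of_nonneg_of_le (Real.exp_pos _).le (Real.exp_le_exp.2 ?_)
    have h2 : (4 / 3 : ℝ) ≤ √2 := Real.le_sqrt_of_sq_le (by norm_num)
    have h3 : (m : ℝ) ≤ c * a := ha.trans (le_mul_of_one_le_left (by linarith) hc)
    have h4 : (4 / 3 : ℝ) * m ≤ √2 * (c * a) := mul_le_mul h2 h3 (by linarith) (by positivity)
    have h5 := mul_le_mul_of_nonneg_right h4 (Real.sqrt_nonneg (Λ * L))
    push_cast
    rw [hx]
    linarith

/-- A complex number of modulus at least `√2 x` has a real or imaginary part of size at least `x`;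
with two signs each, this gives four tails and turns `2√2` into `4`. -/
theorem measure_norm_tail_le (hN : IsNHPP N rate μ) (hT : 0 < T) {φ : ℝ → ℂ}
    (hφ : ContinuousOn φ (Ioo 0 T)) (hφ1 : ∀ t ∈ Ioc 0 T, ‖φ t‖ ≤ 1)
    (hΛ : 0 < cumulativeRate rate T) {L c a : ℝ} (hL : 0 ≤ L) (hc : 1 ≤ c) {m : ℕ} (hm : 1 ≤ m)
    (ha : m ≤ a) :
    μ {ω | a * (4 * c * √(cumulativeRate rate T * L)) ≤ ‖compensatedIntegral N rate T φ ω‖} ≤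
      4 * ENNReal.ofReal (Real.exp (-(c ^ 2 * L)) ^ (2 * m) +
        Real.exp (-√(cumulativeRate rate T * L)) ^ (2 * m)) := by
  have hfin := isFiniteMeasure_rateMeasure hT.le (hN.rate_integrable T hT.le)
  set x := 2 * √2 * c * a * √(cumulativeRate rate T * L) with hx
  have key : ∀ D : ℂ →L[ℝ] ℝ, (∀ z, |D z| ≤ ‖z‖) →
      μ {ω | x ≤ |D (compensatedIntegral N rate T φ ω)|} ≤
      2 * ENNReal.ofReal (Real.exp (-(c ^ 2 * L)) ^ (2 * m) +
        Real.exp (-√(cumulativeRate rate T * L)) ^ (2 * m)) := fun D hD => by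
    have hg : ContinuousOn (fun t => D (φ t)) (Ioo 0 T) := D.continuous.comp_continuousOn hφ
    have hg1 : ∀ t ∈ Ioc 0 T, |D (φ t)| ≤ 1 := fun t ht => (hD _).trans (hφ1 t ht)
    have hpos := hN.measure_tail_le hT hg hg1 hΛ hL hc hm ha
    have hneg := hN.measure_tail_le hT hg.fun_neg (by simpa only [abs_neg] using hg1) hΛ hL hc hm ha
    simp only [compensatedIntegral_neg] at hneg
    simp only [compensatedIntegral_comp_clm hT hφ hφ1] at hpos hneg
    rw [two_mul]
    refine le_trans (measure_mono fun ω hω => ?_)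
      ((measure_union_le _ _).trans (add_le_add hpos hneg))
    exact le_abs.1 (show x ≤ _ from hω)
  have hre := key Complex.reCLM Complex.abs_re_le_norm
  have him := key Complex.imCLM Complex.abs_im_le_norm
  rw [show (4 : ENNReal) = 2 + 2 by norm_num, add_mul]
  refine le_trans (measure_mono fun ω hω => ?_)
    ((measure_union_le _ _).trans (add_le_add hre him))
  simp only [mem_union, mem_ofPred_eq, Complex.reCLM_apply, Complex.imCLM_apply] at hω ⊢
  set F := compensatedIntegral N rate T φ ω
  by_contra! hcon
  have h1 : ‖F‖ ^ 2 = F.re ^ 2 + F.im ^ 2 := by rw [Complex.sq_norm, Complex.normSq_apply]; ring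
  have hx0 : 0 ≤ x := (abs_nonneg _).trans hcon.1.le
  have h2 : F.re ^ 2 < x ^ 2 := by rw [← sq_abs]; gcongr; exact hcon.1
  have h3 : F.im ^ 2 < x ^ 2 := by rw [← sq_abs]; gcongr; exact hcon.2
  have h4 : (a * (4 * c * √(cumulativeRate rate T * L))) ^ 2 = 2 * x ^ 2 := by
    rw [hx]
    simp only [mul_pow, Real.sq_sqrt (show (0 : ℝ) ≤ 2 by norm_num)]
    ring
  have ha0 : 0 ≤ a := (Nat.cast_nonneg m).trans ha
  have h5 := pow_le_pow_left₀ (by positivity) hω 2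
  linarith

/-- Simultaneous control of all Taylor coefficients at one frequency. -/
theorem measure_exists_taylor_le (hN : IsNHPP N rate μ) (hT : 0 < T) {φ : ℝ → ℂ}
    (hφ : ContinuousOn φ (Ioo 0 T)) (hφ1 : ∀ t ∈ Ioc 0 T, ‖φ t‖ ≤ 1)
    (hΛ : 0 < cumulativeRate rate T) {L c : ℝ} (hL : 0 ≤ L) (hc : 1 ≤ c)
    (hA : Real.exp (-(c ^ 2 * L)) ≤ 1 / 4)
    (hE : Real.exp (-√(cumulativeRate rate T * L)) ≤ 1 / 4) :
    μ {ω | ∃ k : ℕ, 2 ^ k * k.factorial * (4 * c * √(cumulativeRate rate T * L)) ≤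
        ‖compensatedIntegral N rate T (fun t => (t / T : ℂ) ^ k * φ t) ω‖} ≤
      ENNReal.ofReal (4 / 3 * (Real.exp (-(c ^ 2 * L)) +
        Real.exp (-√(cumulativeRate rate T * L)))) := by
  set A := Real.exp (-(c ^ 2 * L))
  set E := Real.exp (-√(cumulativeRate rate T * L))
  have hA0 : 0 ≤ A := (Real.exp_pos _).le
  have hE0 : 0 ≤ E := (Real.exp_pos _).le
  -- One factor `y` is kept for the final bound; the others, at most `1/4`, supply the geometric
  -- decay and cancel the factor `4` of the norm tail.
  have hpow : ∀ {y : ℝ}, 0 ≤ y → y ≤ 1 / 4 → ∀ k : ℕ, y ^ (2 * (k + 1)) ≤ y / 4 * (1 / 4) ^ k :=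
    fun {y} hy hy' k => by
      calc y ^ (2 * (k + 1)) = y * y ^ (2 * k + 1) := by ring
        _ ≤ y * y ^ (k + 1) := mul_le_mul_of_nonneg_left
            (pow_le_pow_of_le_one hy (by linarith) (by omega)) hy
        _ ≤ y * (1 / 4) ^ (k + 1) := by gcongr
        _ = _ := by ring
  have hgeo : HasSum (fun k : ℕ => 4 * ((A + E) / 4 * (1 / 4) ^ k)) (4 / 3 * (A + E)) := by
    have h := (hasSum_geometric_of_lt_one (r := 1 / 4) (by norm_num) (by norm_num)).mul_left
      (A + E)
    convert! h using 1
    · ext k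
      ring
    · norm_num
      ring
  rw [ofPred_exists]
  refine (measure_iUnion_le _).trans ?_
  rw [← hgeo.tsum_eq, ENNReal.ofReal_tsum_of_nonneg (fun k => by positivity) hgeo.summable]
  refine ENNReal.tsum_le_tsum fun k => ?_
  have hcont : ContinuousOn (fun t : ℝ => (t / T : ℂ) ^ k * φ t) (Ioo 0 T) := by fun_prop
  have hbd : ∀ t ∈ Ioc 0 T, ‖(t / T : ℂ) ^ k * φ t‖ ≤ 1 := fun t ht => by
    have h1 : ‖(t / T : ℂ)‖ ≤ 1 := by
      rw [← Complex.ofReal_div, Complex.norm_real, Real.norm_of_nonneg (div_nonneg ht.1.le hT.le)]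
      exact div_le_one_of_le₀ ht.2 hT.le
    rw [norm_mul, norm_pow]
    exact mul_le_one₀ (pow_le_one₀ (norm_nonneg _) h1) (norm_nonneg _) (hφ1 t ht)
  refine (hN.measure_norm_tail_le hT hcont hbd hΛ hL hc (m := k + 1) (by omega)
    (by exact_mod_cast succ_le_two_pow_mul_factorial k)).trans ?_
  rw [ENNReal.ofReal_mul (by norm_num), ENNReal.ofReal_ofNat]
  gcongr
  linarith [hpow hA0 hA k, hpow hE0 hE k]

/-- The Gaussian tail is applied to the windows `1` and `-1`, whose compensated integrals are
`±(N(T) - Λ(T))`. -/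
theorem measure_count_deviation_le (hN : IsNHPP N rate μ) (hT : 0 < T)
    (hΛ : 0 < cumulativeRate rate T) {β : ℝ} (hβ : 0 ≤ β) (hβ' : β ≤ 3) :
    μ {ω | β * cumulativeRate rate T ≤ |(N T.toNNReal ω : ℝ) - cumulativeRate rate T|} ≤
      ENNReal.ofReal (2 * Real.exp (-(cumulativeRate rate T * β ^ 2 / 4))) := by
  have hfin := isFiniteMeasure_rateMeasure hT.le (hN.rate_integrable T hT.le)
  have hone : ∀ ω, compensatedIntegral N rate T (fun _ => (1 : ℝ)) ω =
      (N T.toNNReal ω : ℝ) - cumulativeRate rate T := fun ω => by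
    rw [compensatedIntegral, setIntegral_const, setIntegral_const,
      CountingProcess.jumpMeasure_real_Ioc _ _ hT.le,
      rateMeasure_real_Ioc hN.rate_nonneg hN.rate_integrable le_rfl hT.le le_rfl]
    simp [N.zero', cumulativeRate]
  have hx0 : 0 ≤ β * cumulativeRate rate T := by positivity
  have hx3 : β * cumulativeRate rate T ≤ 3 * cumulativeRate rate T := by gcongr
  have hpos := hN.measure_tail_gaussian hT (g := fun _ => 1) continuousOn_const (by simp) hΛ hx0 hx3
  have hneg := hN.measure_tail_gaussian hT (g := fun _ => -1) continuousOn_const (by simp) hΛ hx0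
    hx3
  simp only [compensatedIntegral_neg N rate T (fun _ => 1), hone] at hpos hneg
  have he : (β * cumulativeRate rate T) ^ 2 / (4 * cumulativeRate rate T) =
      cumulativeRate rate T * β ^ 2 / 4 := by field_simp
  rw [he] at hpos hneg
  rw [ENNReal.ofReal_mul (by norm_num), ENNReal.ofReal_ofNat, two_mul]
  refine le_trans (measure_mono fun ω hω => ?_)
    ((measure_union_le _ _).trans (add_le_add hpos hneg))
  exact le_abs.1 (show β * cumulativeRate rate T ≤ _ from hω)

end IsNHPP

/-! ### Uniform control over the frequency band -/

/-- The windowed Fourier kernel `e^{-2πiνt} w(t)`. -/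
noncomputable def fourierWindow (w : ℝ → ℝ) (ν t : ℝ) : ℂ :=
  Complex.exp (-2 * Real.pi * Complex.I * ν * t) * w t

theorem continuousOn_fourierWindow {w : ℝ → ℝ} {s : Set ℝ} (hw : ContinuousOn w s) (ν : ℝ) :
    ContinuousOn (fourierWindow w ν) s := by
  unfold fourierWindow
  exact (by fun_prop : Continuous fun t : ℝ =>
    Complex.exp (-2 * Real.pi * Complex.I * ν * t)).continuousOn.mul
      (Complex.continuous_ofReal.comp_continuousOn hw)

theorem norm_fourierWindow (w : ℝ → ℝ) (ν t : ℝ) : ‖fourierWindow w ν t‖ = |w t| := by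
  have h : (-2 * Real.pi * Complex.I * ν * t : ℂ) = ((-2 * Real.pi * ν * t : ℝ) : ℂ) * Complex.I := by
    push_cast
    ring
  rw [fourierWindow, norm_mul, h, Complex.norm_exp_ofReal_mul_I, one_mul, Complex.norm_real,
    Real.norm_eq_abs]

theorem fourierWindow_eq_exp_mul {T : ℝ} (hT : T ≠ 0) (w : ℝ → ℝ) (ν ν₀ t : ℝ) :
    fourierWindow w ν t = Complex.exp (((-2 * Real.pi * (ν - ν₀) * T : ℝ) : ℂ) * Complex.I *
      (t / T)) * fourierWindow w ν₀ t := by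
  have hT' : (T : ℂ) ≠ 0 := by exact_mod_cast hT
  rw [fourierWindow, fourierWindow, ← mul_assoc, ← Complex.exp_add]
  congr 2
  push_cast
  field_simp
  ring

namespace IsNHPP

variable {Ω : Type*} [MeasurableSpace Ω] {μ : Measure Ω} {N : CountingProcess Ω} {rate : ℝ → ℝ}
  {T : ℝ}

theorem windowedNoise_eq (hN : IsNHPP N rate μ) (hT : 0 ≤ T) (w : ℝ → ℝ) (ω : Ω) (ν : ℝ) :
    windowedNoise N rate w T ω ν = compensatedIntegral N rate T (fourierWindow w ν) ω := by
  rw [compensatedIntegral,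
    setIntegral_rateMeasure hT hN.rate_nonneg (hN.rate_integrable T hT)]
  rfl

/-- A grid of `⌈2γπBT⌉` frequencies suffices to control the noise uniformly on `[0, B]`. -/
theorem measure_not_forall_windowedNoise_le (hN : IsNHPP N rate μ) (hT : 0 < T) {B γ : ℝ}
    (hγ : 1 < γ) (hB : 1 ≤ 2 * γ * Real.pi * B * T) {w : ℝ → ℝ} (hw : ContinuousOn w (Ioo 0 T))
    (hw1 : ∀ t ∈ Ioc 0 T, |w t| ≤ 1) (hΛ : 0 < cumulativeRate rate T) {L c : ℝ} (hL : 0 ≤ L)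
    (hc : 1 ≤ c) (hA : Real.exp (-(c ^ 2 * L)) ≤ 1 / 4)
    (hE : Real.exp (-√(cumulativeRate rate T * L)) ≤ 1 / 4) :
    μ {ω | ¬ ∃ M < 4 * c * √(cumulativeRate rate T * L) * (γ / (γ - 1)),
        ∀ ν ∈ Icc 0 B, ‖windowedNoise N rate w T ω ν‖ ≤ M} ≤
      ENNReal.ofReal (8 * γ * Real.pi * B * T * (Real.exp (-(c ^ 2 * L)) +
        Real.exp (-√(cumulativeRate rate T * L)))) := by
  have hfin := isFiniteMeasure_rateMeasure hT.le (hN.rate_integrable T hT.le)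
  have hπ := Real.pi_pos
  have hγ0 : 0 < γ := by linarith
  have hB0 : 0 < B := by
    by_contra! h
    have h1 : 2 * γ * Real.pi * B * T ≤ 0 :=
      mul_nonpos_of_nonpos_of_nonneg (mul_nonpos_of_nonneg_of_nonpos (by positivity) h) hT.le
    linarith
  set M := 2 * γ * Real.pi * B * T with hM
  set K := ⌈M⌉₊ with hK
  have hK0 : 0 < K := Nat.ceil_pos.2 (by linarith)
  have hMK : M ≤ K := Nat.le_ceil M
  -- Rounding up at most doubles, since `M ≥ 1`.
  have hK2 : (K : ℝ) ≤ 2 * M := by linarith [Nat.ceil_lt_add_one (show 0 ≤ M by linarith)]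
  have hK' : (0 : ℝ) < K := by exact_mod_cast hK0
  set τ := 4 * c * √(cumulativeRate rate T * L) with hτ
  set A := Real.exp (-(c ^ 2 * L)) with hAdef
  set E := Real.exp (-√(cumulativeRate rate T * L)) with hEdef
  have hA0 : 0 < A := Real.exp_pos _
  have hE0 : 0 < E := Real.exp_pos _
  let center : ℕ → ℝ := fun j => (j + 1 / 2) * (B / K)
  let bad : ℕ → Set Ω := fun j => {ω | ∃ k : ℕ, 2 ^ k * k.factorial * τ ≤
    ‖compensatedIntegral N rate T (fun t => (t / T : ℂ) ^ k * fourierWindow w (center j) t) ω‖}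
  have hcont := fun ν => continuousOn_fourierWindow hw ν
  have hbd : ∀ ν, ∀ t ∈ Ioc 0 T, ‖fourierWindow w ν t‖ ≤ 1 := fun ν t ht => by
    rw [norm_fourierWindow]
    exact hw1 t ht
  calc _ ≤ μ (⋃ j ∈ Finset.range K, bad j) := by
        refine measure_mono fun ω hω => ?_
        by_contra hgood
        simp only [bad, mem_iUnion, mem_ofPred_eq, not_exists, not_le] at hgood
        refine hω ?_
        obtain ⟨j₀, hj₀, hmax⟩ := (Finset.range K).exists_max_image
          (fun j => ‖compensatedIntegral N rate T (fourierWindow w (center j)) ω‖)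
          ⟨0, Finset.mem_range.2 hK0⟩
        -- The largest value over the finite grid is still strictly below `τ`, which keeps the
        -- supremum over the whole band strictly below its threshold.
        refine ⟨‖compensatedIntegral N rate T (fourierWindow w (center j₀)) ω‖ + τ / (γ - 1),
          ?_, fun ν hν => ?_⟩
        · have h := hgood j₀ hj₀ 0
          simp only [pow_zero, Nat.factorial_zero, Nat.cast_one, one_mul] at h
          have h2 : τ * (γ / (γ - 1)) = τ + τ / (γ - 1) := by
            have : γ - 1 ≠ 0 := by linarith
            field_simp
            ring
          rw [h2]
          exact add_lt_add_left h _
        · obtain ⟨j, hj, hjν⟩ := exists_center_abs_sub_le hB0 hK0 hν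
          rw [hN.windowedNoise_eq hT.le]
          have hz : ‖((-2 * Real.pi * (ν - center j) * T : ℝ) : ℂ) * Complex.I‖ ≤
              1 / (2 * γ) := by
            rw [norm_mul, Complex.norm_I, mul_one, Complex.norm_real, Real.norm_eq_abs, abs_mul,
              abs_mul, abs_of_pos hT, abs_of_neg (by linarith : -2 * Real.pi < 0)]
            -- The number of cells is chosen for this: `2π · B/(2M) · T = 1/(2γ)`.
            calc _ ≤ -(-2 * Real.pi) * (B / K / 2) * T := by gcongr; linarith
              _ ≤ -(-2 * Real.pi) * (B / M / 2) * T := by gcongr; linarith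
              _ = _ := by rw [hM]; field_simp
          have h := norm_compensatedIntegral_exp_mul_le (N := N) (rate := rate) hT
            (hcont (center j)) (hbd (center j)) hγ hz fun k => (hgood j hj k).le
          have heq : fourierWindow w ν = fun t : ℝ => Complex.exp
              (((-2 * Real.pi * (ν - center j) * T : ℝ) : ℂ) * Complex.I * (t / T)) *
                fourierWindow w (center j) t :=
            funext fun t => fourierWindow_eq_exp_mul hT.ne' w ν (center j) t
          rw [heq]
          exact h.trans (add_le_add_left (hmax j hj) _)
    _ ≤ ∑ j ∈ Finset.range K, μ (bad j) := measure_biUnion_finset_le _ _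
    _ ≤ ∑ j ∈ Finset.range K, ENNReal.ofReal (4 / 3 * (A + E)) :=
        Finset.sum_le_sum fun j _ =>
          hN.measure_exists_taylor_le hT (hcont _) (hbd _) hΛ hL hc hA hE
    _ = ENNReal.ofReal (K * (4 / 3 * (A + E))) := by
        rw [Finset.sum_const, Finset.card_range, nsmul_eq_mul, ENNReal.ofReal_mul hK'.le,
          ENNReal.ofReal_natCast]
    _ ≤ _ := by
        refine ENNReal.ofReal_le_ofReal ?_
        -- The union bound gives `2M · (4/3)(A + E)`, and `8/3 ≤ 4`.
        have h := mul_le_mul_of_nonneg_right hK2 (by positivity : 0 ≤ 4 / 3 * (A + E))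
        have h3 : 8 * γ * Real.pi * B * T * (A + E) = 4 * M * (A + E) := by rw [hM]; ring
        have h4 : 0 < M * (A + E) := by positivity
        rw [h3]
        linarith

end IsNHPP

/-! ### The main theorem -/

theorem mainTheorem5 {Ω : Type*} [MeasurableSpace Ω] (μ : Measure Ω) [IsProbabilityMeasure μ]
    (N : CountingProcess Ω) (rate : ℝ → ℝ) (hN : IsNHPP N rate μ)
    (T B : ℝ) (hT : 1 ≤ T)
    (w : ℝ → ℝ) (hw : ∀ t ∈ Icc 0 T, |w t| ≤ 1)
    (hw_diff : DifferentiableOn ℝ w (Ioo 0 T))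
    (hw_deriv : BddAbove ((fun t => |deriv w t|) '' Ioo 0 T))
    (α β γ : ℝ) (hβ : 0 < β) (hβ_lt : β < 1) (hγ : 1 < γ) (hα : γ / (γ - 1) ≤ α)
    (hB : 1 ≤ 2 * γ * Real.pi * B * T) :
    1 - 8 * γ * Real.pi * B *
          (1 / T ^ (((γ - 1) / γ * α) ^ 2 - 1) +
            T * Real.exp (-√(cumulativeRate rate T * Real.log T))) -
        2 * Real.exp (-(cumulativeRate rate T * β ^ 2 / 4)) ≤
      μ.real {ω |
        ((1 - β) * averageRate rate T < empiricalRate N T ω ∧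
          empiricalRate N T ω < (1 + β) * averageRate rate T) ∧
        BddAbove (range fun ν : Icc (0 : ℝ) B => ‖windowedNoise N rate w T ω ν‖ / T) ∧
        (⨆ ν : Icc (0 : ℝ) B, ‖windowedNoise N rate w T ω ν‖ / T) <
          4 * α * √(averageRate rate T) * √(Real.log T / T) ∧
        4 * α * √(averageRate rate T) * √(Real.log T / T) <
          4 * α * √(empiricalRate N T ω) / √(1 - β) * √(Real.log T / T)} := by
  have hT0 : 0 < T := by linarith
  have hγ0 : 0 < γ := by linarith
  have hγ1 : 0 < γ - 1 := by linarith
  set Λ := cumulativeRate rate T with hΛdef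
  set L := Real.log T with hLdef
  set c := (γ - 1) / γ * α with hcdef
  have hL : 0 ≤ L := Real.log_nonneg hT
  have hΛ0 : 0 ≤ Λ := hN.cumulativeRate_nonneg hT0.le
  have hc : 1 ≤ c := by
    have h := mul_le_mul_of_nonneg_left hα (div_nonneg hγ1.le hγ0.le)
    rwa [div_mul_div_cancel₀ hγ0.ne', div_self hγ1.ne'] at h
  have hαc : α = c * (γ / (γ - 1)) := by rw [hcdef]; field_simp
  have hα0 : 0 < α := lt_of_lt_of_le (by positivity) hα
  set A := Real.exp (-(c ^ 2 * L)) with hA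
  set E := Real.exp (-√(Λ * L)) with hE
  set D := Real.exp (-(Λ * β ^ 2 / 4)) with hD
  have hA0 : 0 < A := Real.exp_pos _
  have hE0 : 0 < E := Real.exp_pos _
  have hD0 : 0 < D := Real.exp_pos _
  have hpow : 1 / T ^ (c ^ 2 - 1) = T * A := by
    rw [one_div, ← Real.rpow_neg hT0.le, Real.rpow_def_of_pos hT0, hA, ← hLdef]
    have hexp : T = Real.exp L := (Real.exp_log hT0).symm
    rw [show L * -(c ^ 2 - 1) = L + -(c ^ 2 * L) by ring, Real.exp_add, ← hexp]
  rw [hpow, ← mul_add, ← mul_assoc]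
  set p := 8 * γ * Real.pi * B * T with hp
  have hp4 : 4 ≤ p := by rw [hp]; linarith
  -- A nonpositive lower bound is trivial. Otherwise `p (A + E) < 1` with `p ≥ 4` yields the
  -- smallness of `A` and `E` used in the union bound, and `E ≤ 1/4` forces `Λ > 0` and `log T > 0`.
  rcases le_or_gt (1 - p * (A + E) - 2 * D) 0 with htriv | hmain
  · exact htriv.trans measureReal_nonneg
  have hA4 : A ≤ 1 / 4 := by nlinarith
  have hE4 : E ≤ 1 / 4 := by nlinarith
  have hΛL : 0 < Λ * L := by
    refine (mul_nonneg hΛ0 hL).lt_of_ne' fun h => ?_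
    rw [hE, h] at hE4
    norm_num at hE4
  have hΛ : 0 < Λ := pos_of_mul_pos_left hΛL hL
  have hL0 : 0 < L := pos_of_mul_pos_right hΛL hΛ0
  set good := {ω |
        ((1 - β) * averageRate rate T < empiricalRate N T ω ∧
          empiricalRate N T ω < (1 + β) * averageRate rate T) ∧
        BddAbove (range fun ν : Icc (0 : ℝ) B => ‖windowedNoise N rate w T ω ν‖ / T) ∧
        (⨆ ν : Icc (0 : ℝ) B, ‖windowedNoise N rate w T ω ν‖ / T) <
          4 * α * √(averageRate rate T) * √(L / T) ∧
        4 * α * √(averageRate rate T) * √(L / T) <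
          4 * α * √(empiricalRate N T ω) / √(1 - β) * √(L / T)} with hgood
  set bad₁ := {ω | ¬ ∃ M < 4 * c * √(Λ * L) * (γ / (γ - 1)),
    ∀ ν ∈ Icc 0 B, ‖windowedNoise N rate w T ω ν‖ ≤ M} with hbad₁
  set bad₂ := {ω | β * Λ ≤ |(N T.toNNReal ω : ℝ) - Λ|} with hbad₂
  have h₁ : μ bad₁ ≤ ENNReal.ofReal (p * (A + E)) :=
    hN.measure_not_forall_windowedNoise_le hT0 hγ hB hw_diff.continuousOn
      (fun t ht => hw t ⟨ht.1.le, ht.2⟩) hΛ hL hc hA4 hE4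
  have h₂ : μ bad₂ ≤ ENNReal.ofReal (2 * D) :=
    hN.measure_count_deviation_le hT0 hΛ hβ.le (by linarith)
  have hB0 : 0 ≤ B := by
    by_contra! h
    have h1 : 2 * γ * Real.pi * B * T ≤ 0 :=
      mul_nonpos_of_nonpos_of_nonneg
        (mul_nonpos_of_nonneg_of_nonpos (by positivity) h.le) hT0.le
    linarith
  have hsub : univ ⊆ good ∪ (bad₁ ∪ bad₂) := by
    intro ω _
    by_contra hω
    simp only [mem_union, not_or] at hω
    obtain ⟨hng, hn₁, hn₂⟩ := hω
    simp only [hbad₁, mem_ofPred_eq, not_not] at hn₁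
    simp only [hbad₂, mem_ofPred_eq, not_le, abs_lt] at hn₂
    obtain ⟨M, hMlt, hM⟩ := hn₁
    have hbound : ∀ ν : Icc (0 : ℝ) B, ‖windowedNoise N rate w T ω ν‖ / T ≤ M / T := fun ν =>
      div_le_div_of_nonneg_right (hM ν ν.2) hT0.le
    have hlow : (1 - β) * averageRate rate T < empiricalRate N T ω := by
      rw [averageRate, empiricalRate, ← mul_div_assoc]
      exact div_lt_div_of_pos_right (by linarith) hT0
    have hupp : empiricalRate N T ω < (1 + β) * averageRate rate T := by
      rw [averageRate, empiricalRate, ← mul_div_assoc]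
      exact div_lt_div_of_pos_right (by linarith) hT0
    have hthr : 4 * α * √(averageRate rate T) * √(L / T) =
        4 * c * √(Λ * L) * (γ / (γ - 1)) / T := by
      rw [averageRate, mul_assoc, ← Real.sqrt_mul (div_nonneg hΛ0 hT0.le), div_mul_div_comm,
        Real.sqrt_div (mul_nonneg hΛ0 hL), Real.sqrt_mul_self hT0.le, hαc]
      ring
    refine hng ⟨⟨hlow, hupp⟩, ⟨M / T, ?_⟩, ?_, ?_⟩
    · rintro _ ⟨ν, rfl⟩
      exact hbound ν
    · have : Nonempty (Icc (0 : ℝ) B) := ⟨⟨0, le_rfl, hB0⟩⟩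
      rw [hthr]
      exact (ciSup_le hbound).trans_lt (div_lt_div_of_pos_right hMlt hT0)
    · have hβ1 : 0 < 1 - β := by linarith
      refine mul_lt_mul_of_pos_right ?_ (Real.sqrt_pos.2 (by positivity))
      rw [mul_div_assoc]
      refine mul_lt_mul_of_pos_left ?_ (by positivity)
      -- The last strict inequality is the lower bound on `N(T)` again: `Λ/T < (N(T)/T) / (1 - β)`.
      rw [← Real.sqrt_div' _ hβ1.le]
      refine Real.sqrt_lt_sqrt (div_nonneg hΛ0 hT0.le) ?_
      rwa [lt_div_iff₀ hβ1, mul_comm]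
  have hAE : 0 ≤ p * (A + E) := by positivity
  have htotal : (1 : ENNReal) ≤ μ good + ENNReal.ofReal (p * (A + E) + 2 * D) := by
    rw [ENNReal.ofReal_add hAE (by positivity), ← measure_univ (μ := μ)]
    exact (measure_mono hsub).trans ((measure_union_le _ _).trans
      (add_le_add le_rfl ((measure_union_le _ _).trans (add_le_add h₁ h₂))))
  have hreal := ENNReal.toReal_mono (by finiteness) htotal
  rw [ENNReal.toReal_add (by finiteness) (by finiteness), ENNReal.toReal_ofReal (by positivity),
    ENNReal.toReal_one] at hreal
  have : 1 ≤ μ.real good + (p * (A + E) + 2 * D) := hreal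
  linarith
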